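/- Throughout, a graph is a finite connected multigraph $G=(V,E)$: multiple edges between two vertices are allowed, but no loops. Its genus is $|E|-|V|+1$. The Cartesian product $G\,\square\,K_2$ with the complete graph $K_2$ on two vertices (joined by a single edge) consists of two disjoint copies of $G$ together with one edge joining the two copies of each vertex of $G$. A divisor on a graph is a formal $\mathbb{Z}$-linear combination $D=\sum_{v} a_v (v)$ of its vertices; its degree is $\sum_v a_v$, and it is effective if $a_v\ge 0$ for all $v$. Firing a vertex $v$ moves one chip from $v$ along each edge incident to $v$ to the other end of that edge; two divisors are equivalent if they differ by a finite sequence of such chip-firing moves. The rank of $D$ is the largest integer $r\ge 0$ such that $D-F$ is equivalent to an effective divisor for every effective divisor $F$ of degree $r$, and $-1$ if no such $r$ exists. The gonality $\operatorname{gon}(G)$ is the smallest degree of a divisor of positive rank. **Theorem.** If $G$ is a graph of genus $1$, then $$\operatorname{gon}(G\,\square\,K_2)=\min\{|V(G)|,4\}.$$ -/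

import Mathlib

/-- A finite loopless multigraph on the vertex type `V`: the edges form a multiset of unordered
pairs of distinct vertices. -/
structure Multigraph (V : Type*) where
  edges : Multiset (Sym2 V)
  loopless : ∀ e ∈ edges, ¬ e.IsDiag

namespace Multigraph

/-- A multigraph is connected if it is nonempty and any two vertices are joined by a path, that is,
if its underlying simple graph is connected. -/
def Connected {V : Type*} (G : Multigraph V) : Prop :=
  (SimpleGraph.fromEdgeSet {e : Sym2 V | e ∈ G.edges}).Connected

/-- The number of edges between `v` and `w`. -/
def mult {V : Type*} [DecidableEq V] (G : Multigraph V) (v w : V) : ℕ :=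
  G.edges.count s(v, w)

/-- The valence of `v`: the number of edges incident to `v`. -/
def valence {V : Type*} [DecidableEq V] (G : Multigraph V) (v : V) : ℕ :=
  G.edges.countP (fun e => v ∈ e)

/-- The genus `|E| - |V| + 1`. -/
def genus {V : Type*} [Fintype V] (G : Multigraph V) : ℤ :=
  (Multiset.card G.edges : ℤ) - (Fintype.card V : ℤ) + 1

/-- The Cartesian product of two multigraphs: a copy of `G` for each vertex of `H` and a copy of `H`
for each vertex of `G`. The theorem `mult_boxProd` below computes its edge multiplicities. -/
def boxProd {V W : Type*} [Fintype V] [Fintype W] (G : Multigraph V) (H : Multigraph W) :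
    Multigraph (V × W) where
  edges := (∑ w : W, G.edges.map (Sym2.map (fun v => (v, w)))) +
    ∑ v : V, H.edges.map (Sym2.map (fun w => (v, w)))
  loopless := by
    intro e he
    rw [Multiset.mem_add, Multiset.mem_sum, Multiset.mem_sum] at he
    rcases he with ⟨w, -, he⟩ | ⟨v, -, he⟩
    · obtain ⟨e', he', rfl⟩ := Multiset.mem_map.1 he
      have h := G.loopless e' he'
      induction e' with
      | _ a b => simpa using h
    · obtain ⟨e', he', rfl⟩ := Multiset.mem_map.1 he
      have h := H.loopless e' he'
      induction e' with
      | _ a b => simpa using h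

/-- The complete graph on two vertices: a single edge between two vertices. -/
def K2 : Multigraph (Fin 2) where
  edges := {s(0, 1)}
  loopless := by
    intro e he
    rw [Multiset.mem_singleton] at he
    subst he
    simp

theorem mult_self {V : Type*} [DecidableEq V] (G : Multigraph V) (v : V) : G.mult v v = 0 := by
  refine Multiset.count_eq_zero.2 fun h => G.loopless _ h ?_
  simp

/-- In the product, `(v₁, w₁)` and `(v₂, w₂)` are joined by `e` edges if `v₁ = v₂` and `w₁`, `w₂`
are joined by `e` edges, or if `w₁ = w₂` and `v₁`, `v₂` are joined by `e` edges; there are no other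
edges. -/
theorem mult_boxProd {V W : Type*} [Fintype V] [Fintype W] [DecidableEq V] [DecidableEq W]
    (G : Multigraph V) (H : Multigraph W) (v₁ v₂ : V) (w₁ w₂ : W) :
    (G.boxProd H).mult (v₁, w₁) (v₂, w₂) =
      (if w₁ = w₂ then G.mult v₁ v₂ else 0) + (if v₁ = v₂ then H.mult w₁ w₂ else 0) := by
  have key1 : ∀ w : W, (G.edges.map (Sym2.map (fun v => (v, w)))).count s((v₁, w₁), (v₂, w₂)) =
      if w = w₁ then (if w₁ = w₂ then G.mult v₁ v₂ else 0) else 0 := by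
    intro w
    by_cases h : w = w₁ ∧ w₁ = w₂
    · obtain ⟨rfl, rfl⟩ := h
      have hinj : Function.Injective (Sym2.map (fun v : V => (v, w))) :=
        Sym2.map.injective (Prod.mk_left_injective w)
      simpa [mult] using Multiset.count_map_eq_count' _ G.edges hinj s(v₁, v₂)
    · have h0 : (G.edges.map (Sym2.map (fun v => (v, w)))).count s((v₁, w₁), (v₂, w₂)) = 0 := by
        refine Multiset.count_eq_zero.2 fun hm => h ?_
        obtain ⟨e, -, he⟩ := Multiset.mem_map.1 hm
        induction e with
        | _ a b =>
          simp only [Sym2.map_mk, Sym2.eq_iff, Prod.mk.injEq] at he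
          grind
      rw [h0]
      split_ifs <;> grind
  have key2 : ∀ v : V, (H.edges.map (Sym2.map (fun w => (v, w)))).count s((v₁, w₁), (v₂, w₂)) =
      if v = v₁ then (if v₁ = v₂ then H.mult w₁ w₂ else 0) else 0 := by
    intro v
    by_cases h : v = v₁ ∧ v₁ = v₂
    · obtain ⟨rfl, rfl⟩ := h
      have hinj : Function.Injective (Sym2.map (fun w : W => (v, w))) :=
        Sym2.map.injective (Prod.mk_right_injective v)
      simpa [mult] using Multiset.count_map_eq_count' _ H.edges hinj s(w₁, w₂)
    · have h0 : (H.edges.map (Sym2.map (fun w => (v, w)))).count s((v₁, w₁), (v₂, w₂)) = 0 := by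
        refine Multiset.count_eq_zero.2 fun hm => h ?_
        obtain ⟨e, -, he⟩ := Multiset.mem_map.1 hm
        induction e with
        | _ a b =>
          simp only [Sym2.map_mk, Sym2.eq_iff, Prod.mk.injEq] at he
          grind
      rw [h0]
      split_ifs <;> grind
  unfold mult at *
  simp only [boxProd, Multiset.count_add, Multiset.count_sum', key1, key2,
    Finset.sum_ite_eq', Finset.mem_univ, if_true]

/-- A divisor: a formal integer combination of the vertices, given by its coefficients (the vertex
set being finite). -/
abbrev Divisor (V : Type*) := V → ℤ

/-- The degree of a divisor is the sum of its coefficients. -/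
def degree {V : Type*} [Fintype V] (D : Divisor V) : ℤ := ∑ v, D v

/-- A divisor is effective if no coefficient is negative. -/
def Effective {V : Type*} (D : Divisor V) : Prop := ∀ v, 0 ≤ D v

/-- Firing the vertex `v`: it loses one chip for each incident edge, and each other vertex `w`
gains one chip for each edge between `v` and `w`. -/
def fire {V : Type*} [DecidableEq V] (G : Multigraph V) (v : V) (D : Divisor V) : Divisor V :=
  fun w => if w = v then D w - G.valence v else D w + G.mult v w

/-- Two divisors are equivalent if they differ by a finite sequence of chip-firing moves. -/
def Equivalent {V : Type*} [DecidableEq V] (G : Multigraph V) : Divisor V → Divisor V → Prop :=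
  Relation.EqvGen fun D D' => ∃ v, D' = G.fire v D

/-- The set of `r ≥ 0` such that `D - F` is equivalent to an effective divisor for every effective
divisor `F` of degree `r`. -/
def rankSet {V : Type*} [Fintype V] [DecidableEq V] (G : Multigraph V) (D : Divisor V) : Set ℕ :=
  {r | ∀ F : Divisor V, Effective F → degree F = r →
    ∃ E : Divisor V, Effective E ∧ G.Equivalent (D - F) E}

open Classical in
/-- The rank of a divisor: the largest element of `rankSet`, or `-1` if there is none.
(On a nonempty vertex set `rankSet` is bounded above, see `isGreatest_rank`.) -/
noncomputable def rank {V : Type*} [Fintype V] [DecidableEq V] (G : Multigraph V)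
    (D : Divisor V) : ℤ :=
  if (G.rankSet D).Nonempty then ((sSup (G.rankSet D) : ℕ) : ℤ) else -1

/-- The gonality: the smallest degree of a divisor of positive rank.
(Such a divisor always has positive degree when there is a vertex.) -/
noncomputable def gonality {V : Type*} [Fintype V] [DecidableEq V] (G : Multigraph V) : ℕ :=
  sInf {k : ℕ | ∃ D : Divisor V, degree D = k ∧ 0 < G.rank D}

theorem valence_eq_sum_mult {V : Type*} [Fintype V] [DecidableEq V] (G : Multigraph V) (v : V) :
    G.valence v = ∑ w, G.mult v w := by
  obtain ⟨s, hs⟩ := G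
  simp only [valence, mult]
  induction s using Multiset.induction_on with
  | empty => simp
  | cons e s ih =>
    have hd := hs e (Multiset.mem_cons_self e s)
    rw [Multiset.countP_cons, ih fun a ha => hs a (Multiset.mem_cons_of_mem ha)]
    simp only [Multiset.count_cons, Finset.sum_add_distrib]
    congr 1
    split_ifs with h
    · obtain ⟨u, rfl⟩ := Sym2.mem_iff_exists.1 h
      have hvu : v ≠ u := by simpa using hd
      rw [Finset.sum_eq_single u]
      · simp
      · intro w _ hw
        refine if_neg ?_
        simp only [Sym2.eq_iff]
        grind
      · simp
    · refine (Finset.sum_eq_zero fun w _ => if_neg ?_).symm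
      rintro rfl
      simp at h

theorem degree_fire {V : Type*} [Fintype V] [DecidableEq V] (G : Multigraph V) (v : V)
    (D : Divisor V) : degree (G.fire v D) = degree D := by
  have h : ∀ w, G.fire v D w = D w + G.mult v w - if w = v then (G.valence v : ℤ) else 0 := by
    intro w
    by_cases hw : w = v
    · subst hw; simp [fire, mult_self]
    · simp [fire, hw]
  simp only [degree, h, Finset.sum_sub_distrib, Finset.sum_add_distrib, Finset.sum_ite_eq',
    Finset.mem_univ, if_true, valence_eq_sum_mult, Nat.cast_sum]
  ring

theorem Equivalent.degree_eq {V : Type*} [Fintype V] [DecidableEq V] {G : Multigraph V}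
    {D D' : Divisor V} (h : G.Equivalent D D') : degree D = degree D' := by
  induction h with
  | rel _ _ h => obtain ⟨v, rfl⟩ := h; exact (degree_fire G v _).symm
  | refl => rfl
  | symm _ _ _ ih => exact ih.symm
  | trans _ _ _ _ _ h₁ h₂ => exact h₁.trans h₂

theorem isGreatest_rank {V : Type*} [Fintype V] [DecidableEq V] [Nonempty V] (G : Multigraph V)
    (D : Divisor V) (h : (G.rankSet D).Nonempty) :
    IsGreatest (G.rankSet D) (sSup (G.rankSet D)) ∧ G.rank D = (sSup (G.rankSet D) : ℕ) := by
  have hb : BddAbove (G.rankSet D) := by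
    refine ⟨(degree D).toNat, fun r hr => ?_⟩
    obtain ⟨v⟩ := ‹Nonempty V›
    obtain ⟨E, hE, hDE⟩ := hr (Pi.single v (r : ℤ))
      (fun w => by by_cases hw : w = v <;> simp [hw]) (by simp [degree])
    have h1 := hDE.degree_eq
    have h2 : 0 ≤ degree E := Finset.sum_nonneg fun w _ => hE w
    simp only [degree, Pi.sub_apply, Finset.sum_sub_distrib, Finset.sum_pi_single',
      Finset.mem_univ, if_true] at h1 h2 ⊢
    omega
  exact ⟨⟨Nat.sSup_mem h hb, fun r hr => le_csSup hb hr⟩, by rw [rank, if_pos h]⟩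

end Multigraph

/-! The divisors equivalent to `D` are the `D - lap w f` for integer scripts `f`, and a script
between effective divisors decomposes into legal firings of sets (`legal_induction`). Positive rank
becomes `Covers`: every vertex carries a chip in some effective representative.

Upper bounds: one chip on each vertex of a row, since firing that row moves them to the other row;
and two chips on both copies of one vertex, since an effective divisor of degree two on a graph of
genus one has positive rank (`CutConnected.exists_covering`).

Lower bound: suppose an effective divisor with at most three chips, and fewer than |V|, covers.
Genus one supplies vertices a ≠ b that no cut of size at most one separates, and a minimum cut
between them has connected sides Q and Qᶜ. Over one side, the largest pile in row 0 and the largest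
in row 1 together have at most one chip, since otherwise there would be four chips. Legally firing a
set with rows A₀, A₁ requires cut A₀ + cut A₁ + |A₀ ∆ A₁| chips. Hence it either treats all copies
of vertices linked to a alike, or, up to complement, fires one small exceptional set in a single row
(`legal_dichotomy`). Exceptional firings do not occur in a covering class
(`Exceptional.not_covers`). Edges leaving Q join vertices linked to a (`TwoLinked.of_boundary`), so
the other firings leave the chips over the poor side fixed (`eq_of_legal_of_chips_le_one`). Both
copies of a (or of b) would then carry a chip from the start, which is too many. -/

namespace Multigraph

/-! ### Laplacians, cuts and legal firings of sets. -/

section Weighted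

/-- The Laplacian of the weighted graph with weights `w`, applied to `f`. -/
def lap {X : Type*} [Fintype X] (w : X → X → ℤ) (f : X → ℤ) (x : X) : ℤ :=
  ∑ y, w x y * (f x - f y)

/-- The integer-valued indicator function of a finite set. -/
def ind {X : Type*} [DecidableEq X] (A : Finset X) (x : X) : ℤ := if x ∈ A then 1 else 0

/-- The total weight of the edges leaving `A`. -/
def cut {X : Type*} [Fintype X] [DecidableEq X] (w : X → X → ℤ) (A : Finset X) : ℤ :=
  ∑ x ∈ A, ∑ y ∈ Aᶜ, w x y

variable {X : Type*} [Fintype X] (w : X → X → ℤ)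

theorem lap_add (f g : X → ℤ) : lap w (f + g) = lap w f + lap w g := by
  funext x
  simp only [lap, Pi.add_apply, ← Finset.sum_add_distrib]
  exact Finset.sum_congr rfl fun y _ => by ring

theorem lap_neg (f : X → ℤ) : lap w (-f) = -lap w f := by
  funext x
  simp only [lap, Pi.neg_apply, ← Finset.sum_neg_distrib]
  exact Finset.sum_congr rfl fun y _ => by ring

theorem lap_sub (f g : X → ℤ) : lap w (f - g) = lap w f - lap w g := by
  rw [sub_eq_add_neg, lap_add, lap_neg, sub_eq_add_neg]

theorem lap_zero : lap w (0 : X → ℤ) = 0 := by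
  funext x; simp [lap]

theorem lap_of_const {f : X → ℤ} {M : ℤ} (h : ∀ x, f x = M) : lap w f = 0 := by
  funext x; simp [lap, h]

theorem sum_lap (hs : ∀ x y, w x y = w y x) (f : X → ℤ) : ∑ x, lap w f x = 0 := by
  have h1 : ∑ x, lap w f x = ∑ x, ∑ y, w x y * (f y - f x) := by
    simp only [lap]
    rw [Finset.sum_comm]
    exact Finset.sum_congr rfl fun y _ => Finset.sum_congr rfl fun x _ => by rw [hs]
  have h2 : ∑ x, lap w f x = -∑ x, ∑ y, w x y * (f y - f x) := by
    simp only [lap, ← Finset.sum_neg_distrib]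
    exact Finset.sum_congr rfl fun y _ => Finset.sum_congr rfl fun x _ => by ring
  omega

variable [DecidableEq X]

/-- The Laplacian summed over a set only sees the edges leaving the set. -/
theorem sum_lap_finset (hs : ∀ x y, w x y = w y x) (f : X → ℤ) (A : Finset X) :
    ∑ x ∈ A, lap w f x = ∑ x ∈ A, ∑ y ∈ Aᶜ, w x y * (f x - f y) := by
  have h0 : ∑ x ∈ A, ∑ y ∈ A, w x y * (f x - f y) = 0 := by
    have h1 : ∑ x ∈ A, ∑ y ∈ A, w x y * (f x - f y) =
        ∑ x ∈ A, ∑ y ∈ A, w x y * (f y - f x) := by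
      rw [Finset.sum_comm]
      exact Finset.sum_congr rfl fun y _ => Finset.sum_congr rfl fun x _ => by rw [hs]
    have h2 : ∑ x ∈ A, ∑ y ∈ A, w x y * (f x - f y) =
        -∑ x ∈ A, ∑ y ∈ A, w x y * (f y - f x) := by
      simp only [← Finset.sum_neg_distrib]
      exact Finset.sum_congr rfl fun y _ => Finset.sum_congr rfl fun x _ => by ring
    omega
  simp only [lap, ← Finset.sum_add_sum_compl A (fun y => w _ y * (f _ - f y)),
    Finset.sum_add_distrib, h0, zero_add]

theorem sum_lap_ind (hs : ∀ x y, w x y = w y x) (A : Finset X) :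
    ∑ x ∈ A, lap w (ind A) x = cut w A := by
  rw [sum_lap_finset w hs, cut]
  refine Finset.sum_congr rfl fun x hx => Finset.sum_congr rfl fun y hy => ?_
  rw [Finset.mem_compl] at hy
  simp [ind, hx, hy]

theorem lap_ind_of_mem {A : Finset X} {x : X} (hx : x ∈ A) :
    lap w (ind A) x = ∑ y ∈ Aᶜ, w x y := by
  rw [lap, ← Finset.sum_add_sum_compl A]
  rw [Finset.sum_eq_zero fun y hy => by simp [ind, hx, hy], zero_add]
  refine Finset.sum_congr rfl fun y hy => ?_
  rw [Finset.mem_compl] at hy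
  simp [ind, hx, hy]

theorem lap_ind_of_notMem {A : Finset X} {x : X} (hx : x ∉ A) :
    lap w (ind A) x = -∑ y ∈ A, w x y := by
  rw [lap, ← Finset.sum_add_sum_compl A, ← Finset.sum_neg_distrib]
  rw [Finset.sum_eq_zero (s := Aᶜ) fun y hy => ?_, add_zero]
  · refine Finset.sum_congr rfl fun y hy => ?_
    simp [ind, hx, hy]
  · rw [Finset.mem_compl] at hy
    simp [ind, hx, hy]

theorem cut_compl (hs : ∀ x y, w x y = w y x) (A : Finset X) : cut w Aᶜ = cut w A := by
  rw [cut, compl_compl, Finset.sum_comm, cut]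
  exact Finset.sum_congr rfl fun y _ => Finset.sum_congr rfl fun x _ => hs _ _

theorem ind_compl (A : Finset X) (x : X) : ind Aᶜ x = 1 - ind A x := by
  by_cases h : x ∈ A <;> simp [ind, h]

theorem lap_ind_compl (A : Finset X) : lap w (ind Aᶜ) = -lap w (ind A) := by
  funext x
  simp only [lap, Pi.neg_apply, ← Finset.sum_neg_distrib, ind_compl]
  exact Finset.sum_congr rfl fun y _ => by ring

theorem cut_nonneg (hw : ∀ x y, 0 ≤ w x y) (A : Finset X) : 0 ≤ cut w A :=
  Finset.sum_nonneg fun _ _ => Finset.sum_nonneg fun _ _ => hw _ _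

theorem le_cut (hw : ∀ x y, 0 ≤ w x y) {A : Finset X} {x y : X} (hx : x ∈ A) (hy : y ∉ A) :
    w x y ≤ cut w A :=
  (Finset.single_le_sum (f := fun y => w x y) (fun _ _ => hw _ _) (Finset.mem_compl.2 hy)).trans
    (Finset.single_le_sum (f := fun x => ∑ y ∈ Aᶜ, w x y)
      (fun _ _ => Finset.sum_nonneg fun _ _ => hw _ _) hx)

/-- Two different edges leaving `A` have total weight at most `cut w A`. -/
theorem add_le_cut (hw : ∀ x y, 0 ≤ w x y) {A : Finset X} {x y x' y' : X} (hx : x ∈ A)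
    (hy : y ∉ A) (hx' : x' ∈ A) (hy' : y' ∉ A) (hne : (x, y) ≠ (x', y')) :
    w x y + w x' y' ≤ cut w A := by
  rw [cut, ← Finset.sum_product' (f := fun x y => w x y),
    ← Finset.sum_pair (f := fun p : X × X => w p.1 p.2) hne]
  refine Finset.sum_le_sum_of_subset_of_nonneg ?_ fun _ _ _ => hw _ _
  intro p hp
  rw [Finset.mem_insert, Finset.mem_singleton] at hp
  rcases hp with rfl | rfl <;> simp [*]

/-- Every nontrivial cut is crossed by an edge. -/
def CutConnected (w : X → X → ℤ) : Prop :=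
  ∀ A : Finset X, A.Nonempty → Aᶜ.Nonempty → ∃ x ∈ A, ∃ y ∉ A, 1 ≤ w x y

/-- Firing the set of maximal points of a script between effective divisors is legal. -/
theorem effective_sub_lap_ind_top (hw : ∀ x y, 0 ≤ w x y) {D f : X → ℤ} {M : ℤ}
    (hD : Effective D) (hD' : Effective (D - lap w f)) (hM : ∀ x, f x ≤ M) :
    Effective (D - lap w (ind {x | f x = M})) := by
  intro x
  rw [Pi.sub_apply]
  by_cases hx : f x = M
  · have h1 := hD' x
    rw [Pi.sub_apply] at h1
    have h2 : lap w (ind {x | f x = M}) x ≤ lap w f x := by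
      refine Finset.sum_le_sum fun y _ => mul_le_mul_of_nonneg_left ?_ (hw x y)
      have := hM y
      simp only [ind, Finset.mem_filter, Finset.mem_univ, true_and, if_pos hx]
      split_ifs <;> omega
    omega
  · have h1 := hD x
    rw [lap_ind_of_notMem w (by simpa using hx)]
    have : 0 ≤ ∑ y ∈ ({x | f x = M} : Finset X), w x y := Finset.sum_nonneg fun _ _ => hw _ _
    omega

/-- A property of effective divisors that is preserved by legal firings of sets of vertices is
preserved by any script between effective divisors. -/
theorem legal_induction (hw : ∀ x y, 0 ≤ w x y) {p : (X → ℤ) → Prop}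
    (hp : ∀ (E : X → ℤ) (A : Finset X), p E → Effective E → Effective (E - lap w (ind A)) →
      p (E - lap w (ind A)))
    {D f : X → ℤ} (h : p D) (hD : Effective D) (hD' : Effective (D - lap w f)) :
    p (D - lap w f) := by
  obtain ⟨M, hM⟩ : ∃ M, ∀ x, f x ≤ M := by
    obtain ⟨M, hM⟩ := (Set.finite_range f).bddAbove
    exact ⟨M, fun x => hM ⟨x, rfl⟩⟩
  obtain ⟨N, hN⟩ : ∃ N : ℕ, ∀ x, M - N ≤ f x := by
    obtain ⟨m, hm⟩ := (Set.finite_range f).bddBelow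
    exact ⟨(M - m).toNat, fun x => by have := hm ⟨x, rfl⟩; omega⟩
  induction N generalizing D f M with
  | zero =>
    rw [lap_of_const w (M := M) fun x => by have := hM x; have := hN x; push_cast at *; omega,
      sub_zero]
    exact h
  | succ N ih =>
    -- `M` is only an upper bound, so `A` may be empty; firing it then changes nothing.
    set A : Finset X := {x | f x = M} with hA
    have h1 := effective_sub_lap_ind_top w hw hD hD' hM
    have h2 : D - lap w f = D - lap w (ind A) - lap w (f - ind A) := by
      rw [lap_sub]; abel
    rw [h2] at hD' ⊢
    refine ih (hp D A h hD h1) h1 hD' (M - 1) (fun x => ?_) fun x => ?_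
    all_goals
      have hx1 := hM x
      have hx2 := hN x
      simp only [Pi.sub_apply, ind, hA, Finset.mem_filter, Finset.mem_univ, true_and]
      push_cast at hx2 ⊢
      split_ifs <;> omega

/-- If a script between effective divisors adds chips to `v`, then some nonempty set of vertices
not containing `v` can be fired legally. -/
theorem exists_legal_of_lt (hw : ∀ x y, 0 ≤ w x y) {D f : X → ℤ} {v : X}
    (hD : Effective D) (hD' : Effective (D - lap w f)) (hv : D v < (D - lap w f) v) :
    ∃ A : Finset X, A.Nonempty ∧ v ∉ A ∧ Effective (D - lap w (ind A)) := by
  obtain ⟨x₀, -, hx₀⟩ := Finset.exists_max_image Finset.univ f ⟨v, Finset.mem_univ v⟩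
  have hM : ∀ x, f x ≤ f x₀ := fun x => hx₀ x (Finset.mem_univ x)
  refine ⟨Finset.univ.filter fun x => f x = f x₀, ⟨x₀, by simp⟩, fun h => ?_,
    effective_sub_lap_ind_top w hw hD hD' hM⟩
  rw [Finset.mem_filter] at h
  replace h := h.2
  -- A vertex where the script is maximal cannot gain chips, so `v` is not one.
  have : 0 ≤ lap w f v := Finset.sum_nonneg fun y _ =>
    mul_nonneg (hw _ _) (by have := hM y; omega)
  rw [Pi.sub_apply] at hv
  omega

/-- The divisor class of `D` has effective members with a chip on any given vertex. -/
def Covers {X : Type*} [Fintype X] (w : X → X → ℤ) (D : X → ℤ) : Prop :=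
  ∀ v, ∃ f, Effective (D - lap w f) ∧ 1 ≤ (D - lap w f) v

theorem Covers.sub_lap {X : Type*} [Fintype X] {w : X → X → ℤ} {D : X → ℤ} (h : Covers w D)
    (g : X → ℤ) : Covers w (D - lap w g) := fun u => by
  obtain ⟨f, hf⟩ := h u
  refine ⟨f - g, ?_⟩
  rwa [show D - lap w g - lap w (f - g) = D - lap w f by rw [lap_sub]; abel]

end Weighted

/-! ### Equivalence, rank and gonality in terms of scripts. -/

section Equivalence

variable {X : Type*} [Fintype X] [DecidableEq X] (H : Multigraph X)

/-- The edge multiplicities as integer weights. -/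
def wt {X : Type*} [DecidableEq X] (H : Multigraph X) (x y : X) : ℤ := H.mult x y

theorem wt_nonneg {X : Type*} [DecidableEq X] (H : Multigraph X) (x y : X) : 0 ≤ H.wt x y := Int.natCast_nonneg _

theorem wt_symm {X : Type*} [DecidableEq X] (H : Multigraph X) (x y : X) : H.wt x y = H.wt y x := by
  rw [wt, wt, mult, mult, Sym2.eq_swap]

theorem fire_eq (v : X) (D : Divisor X) : H.fire v D = D - lap H.wt (Pi.single v 1) := by
  have hi : (Pi.single v 1 : X → ℤ) = ind {v} := by
    funext x; simp [ind, Pi.single_apply]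
  funext x
  rw [Pi.sub_apply, hi]
  by_cases hx : x = v
  · subst hx
    rw [lap_ind_of_mem _ (Finset.mem_singleton_self x), fire, if_pos rfl, valence_eq_sum_mult,
      ← Finset.sum_add_sum_compl {x}]
    simp [mult_self, wt]
  · rw [lap_ind_of_notMem _ (by simpa using hx), fire, if_neg hx, Finset.sum_singleton, wt_symm, wt]
    ring

/-- For the converse, the scripts that produce an equivalent divisor from every divisor form a
subgroup; it contains the indicator of each vertex, hence everything. -/
theorem equivalent_iff {D D' : Divisor X} : H.Equivalent D D' ↔ ∃ f, D' = D - lap H.wt f := by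
  constructor
  · intro h
    induction h with
    | rel _ _ h => obtain ⟨v, rfl⟩ := h; exact ⟨_, H.fire_eq v _⟩
    | refl => exact ⟨0, by rw [lap_zero, sub_zero]⟩
    | symm _ _ _ ih => obtain ⟨f, rfl⟩ := ih; exact ⟨-f, by rw [lap_neg]; abel⟩
    | trans _ _ _ _ _ h₁ h₂ =>
      obtain ⟨f, rfl⟩ := h₁
      obtain ⟨g, rfl⟩ := h₂
      exact ⟨f + g, by rw [lap_add]; abel⟩
  · rintro ⟨f, rfl⟩
    let S : AddSubgroup (X → ℤ) :=
      { carrier := {f | ∀ D, H.Equivalent D (D - lap H.wt f)}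
        add_mem' := fun {f g} hf hg D => by
          have := (hf D).trans _ _ _ (hg (D - lap H.wt f))
          rwa [sub_sub, ← lap_add] at this
        zero_mem' := fun D => by rw [lap_zero, sub_zero]; exact .refl _
        neg_mem' := fun {f} hf D => by
          have := (hf (D - lap H.wt (-f))).symm
          rw [lap_neg, sub_neg_eq_add, add_sub_cancel_right] at this
          rwa [lap_neg, sub_neg_eq_add] }
    have h1 : ∀ v, Pi.single v (1 : ℤ) ∈ S := fun v D => by
      rw [← fire_eq]; exact .rel _ _ ⟨v, rfl⟩
    have h2 : f = ∑ v, f v • (Pi.single v (1 : ℤ) : X → ℤ) := by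
      funext x; simp [Finset.sum_apply, Pi.single_apply]
    have h3 : f ∈ S := by
      rw [h2]; exact S.sum_mem fun v _ => S.zsmul_mem (h1 v) _
    exact h3 D

theorem covers_of_rank_pos {D : Divisor X} (h : 0 < H.rank D) : Covers H.wt D := by
  intro v
  have hne : (H.rankSet D).Nonempty := by
    by_contra hne
    rw [rank, if_neg hne] at h
    omega
  have : Nonempty X := ⟨v⟩
  obtain ⟨⟨hr, -⟩, hr'⟩ := H.isGreatest_rank D hne
  rw [hr'] at h
  set r := sSup (H.rankSet D)
  -- Placing all `r` chips of `F` on `v` avoids having to show that `rankSet` is closed downwards.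
  obtain ⟨E, hE, hDE⟩ := hr (Pi.single v (r : ℤ))
    (fun w => by by_cases hw : w = v <;> simp [hw]) (by simp [degree])
  obtain ⟨f, hf⟩ := H.equivalent_iff.1 hDE
  have key : D - lap H.wt f = E + Pi.single v (r : ℤ) := by rw [hf]; abel
  refine ⟨f, ?_, ?_⟩
  · rw [key]
    intro x
    have := hE x
    by_cases hw : x = v
    · subst hw; simp only [Pi.add_apply, Pi.single_eq_same]; omega
    · simpa [hw] using this
  · rw [key]
    have := hE v
    simp only [Pi.add_apply, Pi.single_eq_same]
    omega

theorem rank_pos_of_covers [Nonempty X] {D : Divisor X} (h : Covers H.wt D) : 0 < H.rank D := by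
  have h1 : 1 ∈ H.rankSet D := by
    intro F hF hd
    obtain ⟨v, hv⟩ : ∃ v, 1 ≤ F v := by
      by_contra! hc
      have : degree F ≤ 0 := Finset.sum_nonpos fun v _ => by have := hc v; omega
      rw [hd] at this
      norm_num at this
    obtain ⟨f, hf, hfv⟩ := h v
    have hFv : ∀ x, x ≠ v → F x = 0 := by
      intro x hx
      have h2 : ∑ y ∈ {x, v}, F y ≤ degree F :=
        Finset.sum_le_sum_of_subset_of_nonneg (Finset.subset_univ _) fun y _ _ => hF y
      rw [Finset.sum_pair hx, hd] at h2
      have := hF x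
      push_cast at h2
      omega
    have hv1 : F v ≤ 1 := by
      have : F v ≤ degree F := Finset.single_le_sum (fun y _ => hF y) (Finset.mem_univ v)
      rw [hd] at this
      exact_mod_cast this
    refine ⟨D - F - lap H.wt f, fun x => ?_, H.equivalent_iff.2 ⟨f, rfl⟩⟩
    have := hf x
    simp only [Pi.sub_apply] at this hfv ⊢
    by_cases hx : x = v
    · subst hx; omega
    · rw [hFv x hx]; omega
  obtain ⟨⟨-, hub⟩, hr⟩ := H.isGreatest_rank D ⟨1, h1⟩
  rw [hr]
  have := hub h1
  omega

theorem gonality_le [Nonempty X] {D : Divisor X} {k : ℕ} (hd : degree D = k) (h : Covers H.wt D) :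
    H.gonality ≤ k :=
  Nat.sInf_le ⟨D, hd, H.rank_pos_of_covers h⟩

/-- Effective divisors suffice, because a covering class has an effective member. The witness `D₀`
is needed since `sInf ∅ = 0`. -/
theorem le_gonality [Nonempty X] {k : ℕ}
    (h : ∀ D : Divisor X, Effective D → Covers H.wt D → (k : ℤ) ≤ degree D) {D₀ : Divisor X} {m : ℕ}
    (hd : degree D₀ = m) (h₀ : Covers H.wt D₀) : k ≤ H.gonality := by
  refine le_csInf ⟨m, D₀, hd, H.rank_pos_of_covers h₀⟩ ?_
  rintro m ⟨D, hd, hD⟩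
  have hc := H.covers_of_rank_pos hD
  obtain ⟨v⟩ := ‹Nonempty X›
  obtain ⟨f, hf, -⟩ := hc v
  have h1 : degree (D - lap H.wt f) = m := by
    rw [← hd]
    simp [degree, Finset.sum_sub_distrib, sum_lap _ H.wt_symm]
  have h2 := h _ hf (hc.sub_lap f)
  rw [h1] at h2
  exact_mod_cast h2

end Equivalence

/-! ### Reduced divisors, minimum cuts and linked vertices. -/

section Weighted

variable {X : Type*} [Fintype X] [DecidableEq X] {w : X → X → ℤ}

theorem CutConnected.one_le_cut (h : CutConnected w) (hw : ∀ x y, 0 ≤ w x y) {A : Finset X}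
    (hA : A.Nonempty) (hA' : Aᶜ.Nonempty) : 1 ≤ cut w A := by
  obtain ⟨x, hx, y, hy, hxy⟩ := h A hA hA'
  exact hxy.trans (le_cut w hw hx hy)

/-- Maximum principle: an edge leaving the set of maxima makes the Laplacian positive at its start.
-/
theorem CutConnected.eq_zero_of_lap_eq_zero (h : CutConnected w) (hw : ∀ x y, 0 ≤ w x y)
    {f : X → ℤ} (hf : lap w f = 0) {v : X} (hv : f v = 0) : f = 0 := by
  have key : ∀ g : X → ℤ, lap w g = 0 → g v = 0 → ∀ x, g x ≤ 0 := by
    intro g hg hgv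
    obtain ⟨x₀, -, hx₀⟩ := Finset.exists_max_image Finset.univ g ⟨v, Finset.mem_univ v⟩
    by_contra! hc
    obtain ⟨z, hz⟩ := hc
    have hM : 0 < g x₀ := hz.trans_le (hx₀ z (Finset.mem_univ z))
    obtain ⟨x, hx, y, hy, hxy⟩ := h {x | g x = g x₀} ⟨x₀, by simp⟩ ⟨v, by simp [hgv]; omega⟩
    simp only [Finset.mem_filter, Finset.mem_univ, true_and] at hx hy
    have h1 : w x y * (g x - g y) ≤ lap w g x :=
      Finset.single_le_sum (f := fun y => w x y * (g x - g y))
        (fun z _ => mul_nonneg (hw _ _) (by have := hx₀ z (Finset.mem_univ z); omega))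
        (Finset.mem_univ y)
    have h2 := hx₀ y (Finset.mem_univ y)
    have h3 : 0 < g x - g y := by omega
    rw [hg, Pi.zero_apply] at h1
    nlinarith
  funext x
  have h1 := key f hf hv x
  have h2 := key (-f) (by rw [lap_neg, hf, neg_zero]) (by simp [hv]) x
  simp only [Pi.neg_apply, Pi.zero_apply] at h2 ⊢
  omega

/-- Dhar's burning argument. As `A` cannot be fired, some `p` in `A` has fewer chips than edges
leaving `A`; remove `p` and induct. For the complement of `v` this bounds the number of chips off
`v` by the genus. -/
theorem mul_sum_le_of_not_legal (hs : ∀ x y, w x y = w y x) (hw : ∀ x y, 0 ≤ w x y) {E : X → ℤ}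
    (hE : Effective E) {v : X}
    (hv : ∀ A : Finset X, A.Nonempty → v ∉ A → ¬ Effective (E - lap w (ind A)))
    (A : Finset X) (hA : v ∉ A) :
    2 * ∑ x ∈ A, E x ≤ ∑ x ∈ A, ∑ y, w x y + cut w A - 2 * A.card := by
  induction hn : A.card generalizing A with
  | zero => rw [Finset.card_eq_zero] at hn; subst hn; simp [cut]
  | succ n ih =>
    have hne : A.Nonempty := Finset.card_pos.1 (by omega)
    have hnot := hv A hne hA
    obtain ⟨p, hp, hpE⟩ : ∃ p ∈ A, E p + 1 ≤ ∑ y ∈ Aᶜ, w p y := by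
      by_contra! hc
      refine hnot fun x => ?_
      rw [Pi.sub_apply]
      by_cases hx : x ∈ A
      · rw [lap_ind_of_mem w hx]
        have := hc x hx
        omega
      · rw [lap_ind_of_notMem w hx]
        have := hE x
        have : 0 ≤ ∑ y ∈ A, w x y := Finset.sum_nonneg fun _ _ => hw _ _
        omega
    have hih := ih (A.erase p) (fun h => hA (Finset.mem_of_mem_erase h))
      (by rw [Finset.card_erase_of_mem hp]; omega)
    have h1 := Finset.add_sum_erase A E hp
    have h2 := Finset.add_sum_erase A (fun x => ∑ y, w x y) hp
    have h3 : cut w A = ∑ y ∈ Aᶜ, w p y + ∑ x ∈ A.erase p, ∑ y ∈ Aᶜ, w x y :=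
      (Finset.add_sum_erase A (fun x => ∑ y ∈ Aᶜ, w x y) hp).symm
    have h4 : cut w (A.erase p) =
        ∑ x ∈ A.erase p, w p x + ∑ x ∈ A.erase p, ∑ y ∈ Aᶜ, w x y := by
      rw [cut, Finset.compl_erase, ← Finset.sum_add_distrib]
      refine Finset.sum_congr rfl fun x _ => ?_
      rw [Finset.sum_insert (by simpa using hp), hs]
    have h5 : ∑ y, w p y = w p p + ∑ x ∈ A.erase p, w p x + ∑ y ∈ Aᶜ, w p y := by
      rw [← Finset.sum_add_sum_compl A, ← Finset.add_sum_erase A _ hp]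
    have h6 := hw p p
    push_cast
    linarith

/-- On a connected graph of genus at most one, an effective divisor of degree two has positive
rank. -/
theorem CutConnected.exists_covering (h : CutConnected w) (hs : ∀ x y, w x y = w y x)
    (hw : ∀ x y, 0 ≤ w x y) (hg : ∑ x, ∑ y, w x y ≤ 2 * Fintype.card X) {D : X → ℤ}
    (hD : Effective D) (hd : ∑ x, D x = 2) (v : X) :
    ∃ f, Effective (D - lap w f) ∧ 1 ≤ (D - lap w f) v := by
  by_contra! hc
  -- The normalisation `f v = 0` makes scripts determined by their results, so there are finitely
  -- many; one of maximal total admits no further legal firing away from `v`.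
  set F : Set (X → ℤ) := {f | f v = 0 ∧ Effective (D - lap w f)} with hF
  have hdeg : ∀ f, ∑ x, (D - lap w f) x = 2 := fun f => by
    simp [Finset.sum_sub_distrib, sum_lap w hs, hd]
  have hfin : F.Finite := by
    refine Set.Finite.of_finite_image (f := fun f => D - lap w f)
      ((Set.finite_Icc (0 : X → ℤ) (fun _ => 2)).subset ?_) ?_
    · rintro _ ⟨f, hf, rfl⟩
      refine ⟨fun x => hf.2 x, fun x => ?_⟩
      rw [← hdeg f]
      exact Finset.single_le_sum (f := D - lap w f) (fun y _ => hf.2 y) (Finset.mem_univ x)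
    · intro f hf g hgF hfg
      have h1 : lap w (f - g) = 0 := by
        have h2 : D - lap w f = D - lap w g := hfg
        rw [lap_sub, sub_right_injective h2, sub_self]
      exact sub_eq_zero.1
        (h.eq_zero_of_lap_eq_zero hw h1 (v := v) (by simp [hf.1, hgF.1]))
  obtain ⟨f, hf, hmax⟩ := Set.exists_max_image F (fun f => ∑ x, f x) hfin
    ⟨0, rfl, by rw [lap_zero, sub_zero]; exact hD⟩
  have hlegal : ∀ A : Finset X, A.Nonempty → v ∉ A →
      ¬ Effective (D - lap w f - lap w (ind A)) := by
    intro A hA hvA hE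
    have h1 := hmax (f + ind A) ⟨by simp [hf.1, ind, hvA], by rwa [lap_add, ← sub_sub]⟩
    simp only [Pi.add_apply, Finset.sum_add_distrib, ind, Finset.sum_ite_mem, Finset.univ_inter,
      Finset.sum_const, nsmul_eq_mul, mul_one] at h1
    have := hA.card_pos
    omega
  -- Burning leaves at most one chip off `v`, while the degree is two and `v` has none.
  have h1 := mul_sum_le_of_not_legal hs hw hf.2 hlegal (Finset.univ.erase v) (by simp)
  have h2 := Finset.add_sum_erase Finset.univ (D - lap w f) (Finset.mem_univ v)
  have h3 := Finset.add_sum_erase Finset.univ (fun x => ∑ y, w x y) (Finset.mem_univ v)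
  have h4 : cut w (Finset.univ.erase v) ≤ ∑ y, w v y := by
    rw [cut, ← Finset.add_sum_erase _ _ (Finset.mem_univ v)]
    have h5 : (Finset.univ.erase v)ᶜ = {v} := by ext; simp
    have h6 : ∑ x ∈ Finset.univ.erase v, ∑ y ∈ {v}, w x y =
        ∑ x ∈ Finset.univ.erase v, w v x :=
      Finset.sum_congr rfl fun x _ => by rw [Finset.sum_singleton, hs]
    rw [h5, h6]
    have := hw v v
    omega
  have h7 := hc f hf.2
  have h8 := hdeg f
  have h9 : (Finset.univ.erase v).card + 1 = Fintype.card X := by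
    rw [Finset.card_erase_add_one (Finset.mem_univ v), Finset.card_univ]
  rw [← h9] at hg
  push_cast at hg
  linarith

/-- No cut of size at most one separates `a` from `b`. -/
def TwoLinked (w : X → X → ℤ) (a b : X) : Prop :=
  ∀ S : Finset X, a ∈ S → b ∉ S → 2 ≤ cut w S

theorem TwoLinked.symm (hs : ∀ x y, w x y = w y x) {a b : X} (h : TwoLinked w a b) :
    TwoLinked w b a := fun S hb ha => by
  rw [← cut_compl w hs]
  exact h _ (by simpa using ha) (by simpa using hb)

theorem TwoLinked.trans {a b c : X} (h : TwoLinked w a b) (h' : TwoLinked w b c) :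
    TwoLinked w a c := fun S ha hc => by
  by_cases hb : b ∈ S
  · exact h' S hb hc
  · exact h S ha hb

/-- The subgraph induced on `Q` is connected. -/
def ConnectedOn (w : X → X → ℤ) (Q : Finset X) : Prop :=
  ∀ S ⊆ Q, S.Nonempty → (Q \ S).Nonempty → ∃ x ∈ S, ∃ y ∈ Q \ S, 1 ≤ w x y

theorem cut_add_cut_of_no_edge (hs : ∀ x y, w x y = w y x) {Q S : Finset X} (hS : S ⊆ Q)
    (h : ∀ x ∈ S, ∀ y ∈ Q \ S, w x y = 0) : cut w S + cut w (Q \ S) = cut w Q := by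
  have h1 : Sᶜ = Q \ S ∪ Qᶜ := by
    ext x; have := @hS x; simp only [Finset.mem_compl, Finset.mem_union, Finset.mem_sdiff]; tauto
  have h2 : (Q \ S)ᶜ = S ∪ Qᶜ := by
    ext x; have := @hS x; simp only [Finset.mem_compl, Finset.mem_union, Finset.mem_sdiff]; tauto
  have d1 : Disjoint (Q \ S) Qᶜ := by
    rw [Finset.disjoint_left]; intro x; simp only [Finset.mem_compl, Finset.mem_sdiff]; tauto
  have d2 : Disjoint S Qᶜ := by
    rw [Finset.disjoint_left]; intro x hx; have := hS hx; simpa using this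
  rw [cut, cut, cut, h1, h2, ← Finset.sum_sdiff hS, add_comm]
  congr 1
  · refine Finset.sum_congr rfl fun x hx => ?_
    rw [Finset.sum_union d2, Finset.sum_eq_zero fun y hy => by rw [hs]; exact h y hy x hx, zero_add]
  · refine Finset.sum_congr rfl fun x hx => ?_
    rw [Finset.sum_union d1, Finset.sum_eq_zero fun y hy => h x hx y hy, zero_add]

/-- Take a minimum cut. If a side fell into two parts without edges between them, their positive
cuts would add up to it, and the part containing the relevant vertex would have a smaller cut. -/
theorem CutConnected.exists_minimal_cut (h : CutConnected w) (hs : ∀ x y, w x y = w y x)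
    (hw : ∀ x y, 0 ≤ w x y) {a b : X} (hab : a ≠ b) :
    ∃ Q : Finset X, a ∈ Q ∧ b ∉ Q ∧ ConnectedOn w Q ∧ ConnectedOn w Qᶜ := by
  have hne : (Finset.univ.filter fun Q : Finset X => a ∈ Q ∧ b ∉ Q).Nonempty :=
    ⟨{a}, by simpa using hab.symm⟩
  obtain ⟨Q, hQ, hmin⟩ := Finset.exists_min_image _ (cut w) hne
  simp only [Finset.mem_filter, Finset.mem_univ, true_and] at hQ hmin
  have key : ∀ (Q : Finset X) (a b : X), a ∈ Q → b ∉ Q →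
      (∀ S : Finset X, a ∈ S → b ∉ S → cut w Q ≤ cut w S) → ConnectedOn w Q := by
    intro Q a b ha hb hmin S hSQ hS hS'
    by_contra! hc
    have h1 := cut_add_cut_of_no_edge hs hSQ fun x hx y hy =>
      le_antisymm (by have := hc x hx y hy; omega) (hw x y)
    have h2 := h.one_le_cut hw hS ⟨b, by simpa using fun hh => hb (hSQ hh)⟩
    have h3 := h.one_le_cut hw hS' ⟨b, by simp [hb]⟩
    by_cases haS : a ∈ S
    · have := hmin S haS fun hh => hb (hSQ hh)
      omega
    · have := hmin (Q \ S) (by simp [ha, haS]) (by simp [hb])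
      omega
  refine ⟨Q, hQ.1, hQ.2, key Q a b hQ.1 hQ.2 fun S h1 h2 => hmin S ⟨h1, h2⟩,
    key Qᶜ b a (by simpa using hQ.2) (by simpa using hQ.1) fun S h1 h2 => ?_⟩
  rw [cut_compl w hs, ← cut_compl w hs S]
  exact hmin Sᶜ ⟨by simpa using h2, by simpa using h1⟩

/-- An edge leaving a connected set with connected complement starts at a vertex that is linked to
any pair of linked vertices separated by the set. -/
theorem TwoLinked.of_boundary (hs : ∀ x y, w x y = w y x) (hw : ∀ x y, 0 ≤ w x y) {a b : X}
    (hab : TwoLinked w a b) {Q : Finset X} (ha : a ∈ Q) (hb : b ∉ Q) (hQ : ConnectedOn w Q)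
    (hQ' : ConnectedOn w Qᶜ) {c d : X} (hc : c ∈ Q) (hd : d ∉ Q) (hcd : 1 ≤ w c d) :
    TwoLinked w a c := by
  intro S haS hcS
  by_cases hbS : b ∈ S
  -- One crossing edge lies inside `Q`, as `S` splits `a` from `c`. The second is the edge between
  -- `c` and `d`, or, if `d ∉ S`, an edge inside `Qᶜ`, where `S` splits `b` from `d`.
  · obtain ⟨x, hx, y, hy, hxy⟩ := hQ (Q ∩ S) Finset.inter_subset_left ⟨a, by simp [ha, haS]⟩
      ⟨c, by simp [hc, hcS]⟩
    simp only [Finset.mem_inter, Finset.mem_sdiff, not_and] at hx hy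
    by_cases hdS : d ∈ S
    · have := add_le_cut w hw hx.2 (hy.2 hy.1) hdS hcS (fun e => hd (by
        rw [Prod.mk.injEq] at e; rw [← e.1]; exact hx.1))
      rw [hs d c] at this
      omega
    · obtain ⟨x', hx', y', hy', hxy'⟩ := hQ' (Qᶜ ∩ S) Finset.inter_subset_left
        ⟨b, by simp [hb, hbS]⟩ ⟨d, by simp [hd, hdS]⟩
      simp only [Finset.mem_inter, Finset.mem_sdiff, not_and, Finset.mem_compl] at hx' hy'
      have := add_le_cut w hw hx.2 (hy.2 hy.1) hx'.2 (hy'.2 hy'.1) (fun e => hx'.1 (by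
        rw [Prod.mk.injEq] at e; rw [← e.1]; exact hx.1))
      omega
  · exact hab S haS hbS

end Weighted

/-! ### Connectivity, and linked vertices in genus one. -/

section Connected

variable {V : Type*} [DecidableEq V] (G : Multigraph V)

theorem one_le_wt_iff {x y : V} : 1 ≤ G.wt x y ↔ s(x, y) ∈ G.edges := by
  rw [wt, mult, ← Multiset.one_le_count_iff_mem]
  norm_cast

theorem adj_fromEdgeSet_iff {V : Type*} (G : Multigraph V) {x y : V} :
    (SimpleGraph.fromEdgeSet {e : Sym2 V | e ∈ G.edges}).Adj x y ↔ s(x, y) ∈ G.edges := by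
  rw [SimpleGraph.fromEdgeSet_adj, Set.mem_ofPred_eq, and_iff_left_iff_imp]
  rintro h rfl
  exact G.loopless _ h (by simp)

theorem exists_adj_of_reachable {V : Type*} {H : SimpleGraph V} {A : Set V} {a b : V} (h : H.Reachable a b)
    (ha : a ∈ A) (hb : b ∉ A) : ∃ x ∈ A, ∃ y ∉ A, H.Adj x y := by
  obtain ⟨p⟩ := h
  obtain ⟨d, -, hd1, hd2⟩ := p.exists_boundary_dart A ha hb
  exact ⟨d.fst, hd1, d.snd, hd2, d.adj⟩

variable [Fintype V]

variable {G} in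
theorem Connected.cutConnected (h : G.Connected) : CutConnected G.wt := by
  rintro A ⟨a, ha⟩ ⟨b, hb⟩
  obtain ⟨x, hx, y, hy, hxy⟩ := exists_adj_of_reachable (A := A) (h.preconnected a b)
    (by simpa using ha) (by simpa using hb)
  exact ⟨x, by simpa using hx, y, by simpa using hy,
    G.one_le_wt_iff.2 (G.adj_fromEdgeSet_iff.1 hxy)⟩

theorem sum_wt : ∑ x, ∑ y, G.wt x y = 2 * Multiset.card G.edges := by
  obtain ⟨s, hs⟩ := G
  simp only [wt, mult]
  induction s using Multiset.induction_on with
  | empty => simp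
  | cons e s ih =>
    have hd := hs e (Multiset.mem_cons_self e s)
    have ih' := ih fun a ha => hs a (Multiset.mem_cons_of_mem ha)
    simp only [Multiset.count_cons, Nat.cast_add, Finset.sum_add_distrib, ih', Multiset.card_cons,
      Nat.cast_one, mul_add]
    congr 1
    induction e with
    | _ u v =>
    have huv : u ≠ v := by simpa using hd
    have h1 : ∀ x y : V, ((if s(x, y) = s(u, v) then 1 else 0 : ℕ) : ℤ) =
        (if x = u then if y = v then 1 else 0 else 0) +
        (if x = v then if y = u then 1 else 0 else 0) := by
      intro x y
      simp only [Sym2.eq_iff]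
      split_ifs <;> grind
    simp only [h1, Finset.sum_add_distrib]
    simp

variable {G} in
/-- In a connected graph of genus one some pair of vertices lies on a common cycle. -/
theorem Connected.exists_twoLinked (h : G.Connected) (hg : G.genus = 1) :
    ∃ a b, a ≠ b ∧ TwoLinked G.wt a b := by
  by_cases hdup : ∃ x y, 2 ≤ G.wt x y
  · obtain ⟨x, y, hxy⟩ := hdup
    refine ⟨x, y, ?_, fun S hx hy => hxy.trans (le_cut _ G.wt_nonneg hx hy)⟩
    rintro rfl
    rw [wt, mult_self] at hxy
    norm_num at hxy
  · push Not at hdup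
    classical
    -- Without multiple edges this simple graph has |V| edges, so it is not a tree and some edge is
    -- not a bridge. Any cut between the ends of that edge is crossed a second time.
    set H := SimpleGraph.fromEdgeSet {e : Sym2 V | e ∈ G.edges} with hH
    have hnd : G.edges.Nodup := Multiset.nodup_iff_count_le_one.2 fun e => by
      induction e with
      | _ x y => have := hdup x y; rw [wt, mult] at this; omega
    have hE : H.edgeFinset.card = Multiset.card G.edges := by
      have : H.edgeFinset = ⟨G.edges, hnd⟩ := by
        ext e
        induction e with
        | _ x y =>
          rw [SimpleGraph.mem_edgeFinset, SimpleGraph.mem_edgeSet, hH, adj_fromEdgeSet_iff]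
          rfl
      rw [this]; rfl
    have hna : ¬ H.IsAcyclic := fun hac => by
      have h1 := (SimpleGraph.IsTree.mk h hac).card_edgeFinset
      rw [hE] at h1
      rw [genus] at hg
      omega
    rw [SimpleGraph.isAcyclic_iff_forall_adj_isBridge] at hna
    push Not at hna
    obtain ⟨a, b, hab, hbr⟩ := hna
    rw [SimpleGraph.isBridge_iff] at hbr
    have hreach : (H.deleteEdges {s(a, b)}).Reachable a b := by tauto
    refine ⟨a, b, hab.ne, fun S ha hb => ?_⟩
    obtain ⟨x, hx, y, hy, hxy⟩ := exists_adj_of_reachable (A := S) hreach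
      (by simpa using ha) (by simpa using hb)
    rw [SimpleGraph.deleteEdges_adj] at hxy
    have h1 := G.one_le_wt_iff.2 (G.adj_fromEdgeSet_iff.1 hxy.1)
    have h2 := G.one_le_wt_iff.2 (G.adj_fromEdgeSet_iff.1 hab)
    have h3 := add_le_cut G.wt G.wt_nonneg (A := S) (by simpa using hx) (by simpa using hy) ha hb
      (fun e => hxy.2 (by rw [Prod.mk.injEq] at e; rw [e.1, e.2]; rfl))
    omega

end Connected

/-! ### Legal firings on the product with `K2`. -/

section Prism

variable {V : Type*} [DecidableEq V] {w : V → V → ℤ}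

/-- The weights of the Cartesian product with `K2`. -/
def prism (w : V → V → ℤ) (p q : V × Fin 2) : ℤ :=
  (if p.2 = q.2 then w p.1 q.1 else 0) + (if p.1 = q.1 then if p.2 = q.2 then 0 else 1 else 0)

theorem prism_symm (hs : ∀ x y, w x y = w y x) (p q : V × Fin 2) : prism w p q = prism w q p := by
  simp only [prism, hs p.1 q.1, eq_comm]

theorem prism_nonneg (hw : ∀ x y, 0 ≤ w x y) (p q : V × Fin 2) : 0 ≤ prism w p q := by
  have := hw p.1 q.1
  unfold prism
  split_ifs <;> omega

variable [Fintype V]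

theorem wt_boxProd_K2 (G : Multigraph V) : (G.boxProd K2).wt = prism G.wt := by
  funext p q
  obtain ⟨v, i⟩ := p
  obtain ⟨u, j⟩ := q
  have h : K2.mult i j = if i = j then 0 else 1 := by
    fin_cases i <;> fin_cases j <;> rfl
  rw [wt, mult_boxProd, h, prism, wt]
  push_cast
  rfl

theorem sum_prod_fin_two {V : Type*} [Fintype V] (F : V × Fin 2 → ℤ) (i : Fin 2) :
    ∑ p, F p = ∑ v, F (v, i) + ∑ v, F (v, i + 1) := by
  rw [Fintype.sum_prod_type_right, Fin.sum_univ_two]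
  fin_cases i
  · rfl
  · exact add_comm _ _

theorem lap_prism (f : V × Fin 2 → ℤ) (v : V) (i : Fin 2) :
    lap (prism w) f (v, i) = lap w (fun u => f (u, i)) v + (f (v, i) - f (v, i + 1)) := by
  have hi : i ≠ i + 1 := by fin_cases i <;> decide
  rw [lap, sum_prod_fin_two _ i]
  simp [prism, hi, lap]

/-- The vertices `v` such that the copy of `v` in row `i` belongs to `A`. -/
def row (A : Finset (V × Fin 2)) (i : Fin 2) : Finset V := {v | (v, i) ∈ A}

theorem mem_row {A : Finset (V × Fin 2)} {i : Fin 2} {v : V} : v ∈ row A i ↔ (v, i) ∈ A := by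
  simp [row]

theorem row_compl (A : Finset (V × Fin 2)) (i : Fin 2) : row Aᶜ i = (row A i)ᶜ := by
  ext; simp [mem_row]

theorem lap_prism_ind (A : Finset (V × Fin 2)) (v : V) (i : Fin 2) :
    lap (prism w) (ind A) (v, i) =
      lap w (ind (row A i)) v + (ind (row A i) v - ind (row A (i + 1)) v) := by
  have h : ∀ u j, ind A (u, j) = ind (row A j) u := fun u j => by simp only [ind, mem_row]
  rw [lap_prism]
  simp only [h]

theorem lap_row_le {E : V × Fin 2 → ℤ} {A : Finset (V × Fin 2)}
    (hA : Effective (E - lap (prism w) (ind A))) {i : Fin 2} {v : V} (hv : v ∈ row A i) :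
    lap w (ind (row A i)) v + (1 - ind (row A (i + 1)) v) ≤ E (v, i) := by
  have := hA (v, i)
  rw [Pi.sub_apply, lap_prism_ind] at this
  have h1 : ind (row A i) v = 1 := by simp [ind, hv]
  omega

theorem sum_one_sub_ind (S T : Finset V) : ∑ v ∈ S, (1 - ind T v) = (S \ T).card := by
  simp_rw [← ind_compl]
  simp only [ind, Finset.sum_ite_mem, Finset.sdiff_eq_inter_compl, Finset.sum_const, nsmul_eq_mul,
    mul_one]

/-- Edges inside the fired part of a row cancel. What must be paid for is its cut, and one chip for
each fired vertex whose other copy is not fired. -/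
theorem cut_row_le (hs : ∀ x y, w x y = w y x) {E : V × Fin 2 → ℤ} {A : Finset (V × Fin 2)}
    (hA : Effective (E - lap (prism w) (ind A))) (i : Fin 2) :
    cut w (row A i) + (row A i \ row A (i + 1)).card ≤ ∑ v ∈ row A i, E (v, i) := by
  rw [← sum_lap_ind w hs, ← sum_one_sub_ind, ← Finset.sum_add_distrib]
  exact Finset.sum_le_sum fun v hv => lap_row_le hA hv

theorem sum_row_le {V : Type*} [Fintype V] {E : V × Fin 2 → ℤ} (hE : Effective E) (S : Finset V) (i : Fin 2) :
    ∑ v ∈ S, E (v, i) ≤ ∑ v, E (v, i) :=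
  Finset.sum_le_sum_of_subset_of_nonneg (Finset.subset_univ _) fun _ _ _ => hE _

theorem cut_rows_le (hs : ∀ x y, w x y = w y x) {E : V × Fin 2 → ℤ} (hE : Effective E)
    {A : Finset (V × Fin 2)} (hA : Effective (E - lap (prism w) (ind A))) (i : Fin 2) :
    cut w (row A i) + cut w (row A (i + 1)) + (row A i \ row A (i + 1)).card +
      (row A (i + 1) \ row A i).card ≤ ∑ p, E p := by
  have h1 := cut_row_le hs hA i
  have h2 := cut_row_le hs hA (i + 1)
  have h3 := sum_row_le hE (row A i) i
  have h4 := sum_row_le hE (row A (i + 1)) (i + 1)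
  have hi : i + 1 + 1 = i := by fin_cases i <;> rfl
  rw [hi] at h2
  rw [sum_prod_fin_two E i]
  omega

/-- The sets of vertices that three chips in one row can fire across a cycle. -/
def Exceptional (w : V → V → ℤ) (S : Finset V) : Prop :=
  (S.card = 1 ∧ cut w S = 2 ∧ ∃ x ∈ S, ∃ y ∉ S, TwoLinked w x y) ∨ (S.card = 2 ∧ cut w S = 1)

/-- A set fired legally with at most three chips does not separate linked vertices, unless it is
exceptional up to complementation. -/
theorem legal_dichotomy (hc : CutConnected w) (hs : ∀ x y, w x y = w y x)
    (hw : ∀ x y, 0 ≤ w x y) {a b : V} (hab : a ≠ b) (hl : TwoLinked w a b)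
    {E : V × Fin 2 → ℤ} (hE : Effective E) (hd3 : ∑ p, E p ≤ 3) (hdn : ∑ p, E p < Fintype.card V)
    {A : Finset (V × Fin 2)} (hA : Effective (E - lap (prism w) (ind A))) :
    (∀ v i, TwoLinked w a v → ((v, i) ∈ A ↔ (a, 0) ∈ A)) ∨
      ∃ S i, Exceptional w S ∧
        ((row A i = S ∧ row A (i + 1) = ∅) ∨ (row Aᶜ i = S ∧ row Aᶜ (i + 1) = ∅)) := by
  have haa : TwoLinked w a a := fun S h h' => absurd h h'
  have hcut0 : ∀ S : Finset V, cut w S < 1 → S = ∅ ∨ S = Finset.univ := fun S h => by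
    by_contra! h'
    have := hc.one_le_cut hw h'.1 (by
      rw [Finset.nonempty_iff_ne_empty, Ne, Finset.compl_eq_empty_iff]; exact h'.2)
    omega
  have hne : ∀ S : Finset V, cut w S < 1 → S.Nonempty → S = Finset.univ := fun S h h' =>
    (hcut0 S h).resolve_left h'.ne_empty
  have hcn := cut_nonneg w hw
  by_cases hsplit : ∃ i x y, TwoLinked w x y ∧ x ∈ row A i ∧ y ∉ row A i
  · obtain ⟨i, x, y, hxy, hx, hy⟩ := hsplit
    right
    have h1 := hxy _ hx hy
    have h2 := cut_rows_le hs hE hA i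
    -- If the other row also had a positive cut, all three chips would be spent on cuts; the rows
    -- would coincide and cost at least four.
    have h3 : cut w (row A (i + 1)) < 1 := by
      by_contra! h3
      have h4 : row A i \ row A (i + 1) = ∅ := Finset.card_eq_zero.1 (by omega)
      have h5 : row A (i + 1) \ row A i = ∅ := Finset.card_eq_zero.1 (by omega)
      have h6 : row A i = row A (i + 1) :=
        (Finset.sdiff_eq_empty_iff_subset.1 h4).antisymm (Finset.sdiff_eq_empty_iff_subset.1 h5)
      rw [← h6] at h2
      omega
    rcases hcut0 _ h3 with h0 | h0
    · refine ⟨row A i, i, .inl ?_, .inl ⟨rfl, h0⟩⟩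
      have h4 : 1 ≤ (row A i).card := Finset.card_pos.2 ⟨x, hx⟩
      have := hcn (row A (i + 1))
      simp only [h0, Finset.sdiff_empty, Finset.empty_sdiff, Finset.card_empty] at h2 this
      exact ⟨by omega, by omega, x, hx, y, hy, hxy⟩
    · refine ⟨row Aᶜ i, i, .inl ?_, .inr ⟨rfl, by rw [row_compl, h0, Finset.compl_univ]⟩⟩
      have hy' : y ∈ row Aᶜ i := by rw [row_compl]; simpa using hy
      have h4 : 1 ≤ (row Aᶜ i).card := Finset.card_pos.2 ⟨y, hy'⟩
      have := hcn (row A (i + 1))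
      rw [h0, ← Finset.compl_eq_univ_sdiff, ← row_compl] at h2
      rw [h0] at this
      refine ⟨by omega, ?_, y, hy', x, by rw [row_compl]; simpa using hx, hxy.symm hs⟩
      rw [row_compl, cut_compl w hs]
      omega
  push Not at hsplit
  have hrow : ∀ v i, TwoLinked w a v → (v ∈ row A i ↔ a ∈ row A i) := fun v i hv =>
    ⟨fun h => hsplit i v a (hv.symm hs) h, fun h => hsplit i a v hv h⟩
  by_cases hsame : a ∈ row A 0 ↔ a ∈ row A 1
  · refine .inl fun v i hv => ?_
    rw [← mem_row, ← mem_row, hrow v i hv]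
    fin_cases i
    · rfl
    · exact hsame.symm
  right
  obtain ⟨i, hi, hi'⟩ : ∃ i, a ∈ row A i ∧ a ∉ row A (i + 1) := by
    by_cases h0 : a ∈ row A 0
    · exact ⟨0, h0, fun h => hsame ⟨fun _ => h, fun _ => h0⟩⟩
    · exact ⟨1, by tauto, h0⟩
  have h2 := cut_rows_le hs hE hA i
  -- Both `a` and `b` lie in exactly one row, so at most one chip remains for cuts and some row is
  -- empty or full. One full and one empty row would cost |V| chips.
  have hab2 : 2 ≤ (row A i \ row A (i + 1)).card := by
    refine (Finset.card_pair hab).symm.le.trans (Finset.card_le_card fun v hv => ?_)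
    rw [Finset.mem_insert, Finset.mem_singleton] at hv
    have hv' : TwoLinked w a v := by rcases hv with rfl | rfl <;> assumption
    rw [Finset.mem_sdiff, hrow v i hv', hrow v (i + 1) hv']
    exact ⟨hi, hi'⟩
  have hn1 := hcn (row A i)
  have hn2 := hcn (row A (i + 1))
  by_cases h3 : cut w (row A i) < 1
  · have h4 := hne _ h3 ⟨a, hi⟩
    rw [h4, ← Finset.compl_eq_univ_sdiff, ← row_compl] at h2 hab2
    rw [h4] at hn1
    by_cases h5 : cut w (row A (i + 1)) < 1
    · rcases hcut0 _ h5 with h6 | h6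
      · rw [row_compl, h6, Finset.compl_empty, Finset.card_univ] at h2
        rw [h6] at hn2
        omega
      · rw [h6] at hi'
        exact absurd (Finset.mem_univ a) hi'
    · refine ⟨row Aᶜ (i + 1), i + 1, .inr ⟨by omega, ?_⟩, .inr ⟨rfl, ?_⟩⟩
      · rw [row_compl, cut_compl w hs]
        omega
      · have hi2 : i + 1 + 1 = i := by fin_cases i <;> rfl
        rw [hi2, row_compl, h4, Finset.compl_univ]
  · have h5 : cut w (row A (i + 1)) < 1 := by omega
    have h6 : row A (i + 1) = ∅ := (hcut0 _ h5).resolve_right fun h => by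
      rw [h] at hi'
      exact hi' (Finset.mem_univ a)
    simp only [h6, Finset.sdiff_empty, Finset.empty_sdiff, Finset.card_empty] at h2 hab2 hn2
    exact ⟨row A i, i, .inr ⟨by omega, by omega⟩, .inl ⟨rfl, h6⟩⟩

/-- A disconnection would split `cut w S` into two positive parts. This is impossible if the cut is
one; if it is two, the part containing `y` has cut one and separates it from `x`. -/
theorem Exceptional.connectedOn_compl (hc : CutConnected w) (hs : ∀ x y, w x y = w y x)
    (hw : ∀ x y, 0 ≤ w x y) {S : Finset V} (h : Exceptional w S) : ConnectedOn w Sᶜ := by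
  intro M hM hne hne'
  by_contra! hcon
  have h1 := cut_add_cut_of_no_edge hs hM fun x hx y hy =>
    le_antisymm (by have := hcon x hx y hy; omega) (hw x y)
  obtain ⟨s, hsS⟩ : S.Nonempty := Finset.card_pos.1 (by rcases h with h | h <;> omega)
  have hsM : s ∉ M := fun h => by simpa [hsS] using hM h
  have h2 := hc.one_le_cut hw hne ⟨s, by simpa using hsM⟩
  have h3 := hc.one_le_cut hw hne' ⟨s, by simp [hsS]⟩
  rw [cut_compl w hs] at h1
  rcases h with ⟨-, h4, x, hx, y, hy, hxy⟩ | h4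
  · have hxM : x ∉ M := fun h => by simpa [hx] using hM h
    by_cases hyM : y ∈ M
    · have := hxy.symm hs M hyM hxM
      omega
    · have := hxy.symm hs (Sᶜ \ M) (by simp [hy, hyM]) (by simp [hx])
      omega
  · omega

/-- The result of firing an exceptional set with three chips does not have positive rank. -/
theorem Exceptional.not_covers (hc : CutConnected w) (hs : ∀ x y, w x y = w y x)
    (hw : ∀ x y, 0 ≤ w x y) {S : Finset V} (h : Exceptional w S) {E : V × Fin 2 → ℤ}
    (hE : Effective E) (hd3 : ∑ p, E p ≤ 3) (hdn : ∑ p, E p < Fintype.card V)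
    {A : Finset (V × Fin 2)} (hA : Effective (E - lap (prism w) (ind A))) {i : Fin 2}
    (hAi : row A i = S) (hAi' : row A (i + 1) = ∅) : ¬ Covers (prism w) E := by
  intro hcov
  have hi2 : i + 1 + 1 = i := by fin_cases i <;> rfl
  have hcard : (S.card : ℤ) + cut w S = 3 := by rcases h with h | h <;> omega
  set E' := E - lap (prism w) (ind A) with hE'
  have hE'A := hcov.sub_lap (ind A)
  rw [← hE'] at hE'A
  -- all three chips lie on the fired set
  have h1 := cut_row_le hs hA i
  rw [hAi, hAi', Finset.sdiff_empty] at h1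
  have h2 := sum_row_le hE S i
  have h3 := sum_prod_fin_two E i
  have h4 : 0 ≤ ∑ v, E (v, i + 1) := Finset.sum_nonneg fun v _ => hE _
  have hoff : ∀ v, E (v, i + 1) = 0 := fun v =>
    (Finset.sum_eq_zero_iff_of_nonneg fun v _ => hE (v, i + 1)).1 (by omega) v (Finset.mem_univ v)
  have hoff' : ∀ v ∉ S, E (v, i) = 0 := fun v hv => by
    have h5 := Finset.sum_add_sum_compl S fun v => E (v, i)
    exact (Finset.sum_eq_zero_iff_of_nonneg fun v _ => hE (v, i)).1 (by omega) v
      (Finset.mem_compl.2 hv)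
  -- the chips after firing
  have hup : ∀ v, E' (v, i + 1) = ind S v := fun v => by
    rw [hE', Pi.sub_apply, lap_prism_ind, hi2, hAi, hAi', hoff, lap_ind_of_notMem w (by simp)]
    simp [ind]
  have hside : ∀ v ∉ S, E' (v, i) = ∑ y ∈ S, w v y := fun v hv => by
    rw [hE', Pi.sub_apply, lap_prism_ind, hAi, hAi', hoff' v hv, lap_ind_of_notMem w hv]
    simp [ind, hv]
  have hzero : ∀ v ∈ S, E' (v, i) = 0 := by
    have h5 : ∑ v ∈ S, E' (v, i) ≤ 0 := by
      have h6 : ∑ v ∈ S, E' (v, i) = ∑ v ∈ S, E (v, i) - (cut w S + S.card) := by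
        rw [← sum_lap_ind w hs, Finset.card_eq_sum_ones, Nat.cast_sum, ← Finset.sum_add_distrib,
          ← Finset.sum_sub_distrib]
        refine Finset.sum_congr rfl fun v hv => ?_
        rw [hE', Pi.sub_apply, lap_prism_ind, hAi, hAi']
        simp [ind, hv]
      omega
    have h6 : ∑ v ∈ S, E' (v, i) = 0 := le_antisymm h5 (Finset.sum_nonneg fun v _ => hA _)
    exact (Finset.sum_eq_zero_iff_of_nonneg fun v _ => hA (v, i)).1 h6
  have hSc : S.card < Fintype.card V := by
    have := cut_nonneg w hw S
    omega
  obtain ⟨u, hu⟩ : ∃ u, u ∉ S := by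
    by_contra! hall
    rw [Finset.eq_univ_of_forall hall, Finset.card_univ] at hSc
    omega
  -- After the firing, `(u, i + 1)` has no chip, so bringing one there needs a legal firing of a set
  -- `B` that avoids it. The rest shows that the chips cannot pay for any such `B`.
  obtain ⟨f, hf, hfu⟩ := hE'A (u, i + 1)
  obtain ⟨B, hBne, huB, hB⟩ := exists_legal_of_lt _ (prism_nonneg hw) hA hf (v := (u, i + 1))
    (by rw [hup, ind, if_neg hu]; omega)
  have hlapn : ∀ (T : Finset V) (v : V), v ∈ T → 0 ≤ lap w (ind T) v := fun T v hv => by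
    rw [lap_ind_of_mem w hv]
    exact Finset.sum_nonneg fun _ _ => hw _ _
  have hindle : ∀ (T : Finset V) (v : V), 0 ≤ 1 - ind T v := fun T v => by
    unfold ind; split_ifs <;> omega
  -- the far row is not fired outside `S`
  have hT1 : row B (i + 1) ⊆ S := by
    by_contra hnot
    rw [Finset.not_subset] at hnot
    obtain ⟨m, hm, hmS⟩ := hnot
    obtain ⟨x, hx, y, hy, hxy⟩ := h.connectedOn_compl hc hs hw (row B (i + 1) ∩ Sᶜ)
      Finset.inter_subset_right ⟨m, by simp [hm, hmS]⟩ ⟨u, by simp [hu, mem_row, huB]⟩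
    simp only [Finset.mem_inter, Finset.mem_compl, Finset.mem_sdiff, not_and, not_not] at hx hy
    have hyB : y ∉ row B (i + 1) := fun hh => hy.1 (hy.2 hh)
    have h5 := lap_row_le hB hx.1
    rw [hup, lap_ind_of_mem w hx.1] at h5
    have h6 : w x y ≤ ∑ z ∈ (row B (i + 1))ᶜ, w x z :=
      Finset.single_le_sum (f := fun z => w x z) (fun z _ => hw x z) (Finset.mem_compl.2 hyB)
    have h7 := hindle (row B (i + 1 + 1)) x
    have h8 : ind S x = 0 := by simp [ind, hx.2]
    omega
  -- The copies of `S` in row `i` have no chips left, so none of them can pay for the edge to an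
  -- unfired copy.
  have hT0 : row B i ∩ S ⊆ row B (i + 1) := by
    intro v hv
    rw [Finset.mem_inter] at hv
    by_contra hv'
    have h5 := lap_row_le hB hv.1
    rw [hzero v hv.2] at h5
    have h6 := hlapn _ _ hv.1
    have h7 : ind (row B (i + 1)) v = 0 := by simp [ind, hv']
    omega
  have hdiff : row B i \ row B (i + 1) = row B i \ S := by
    ext v
    have h5 := @hT1 v
    have h6 := @hT0 v
    simp only [Finset.mem_inter, Finset.mem_sdiff] at *
    tauto
  have hrow0 := cut_row_le hs hB i
  have hrow1 := cut_row_le hs hB (i + 1)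
  have hchips0 : ∑ v ∈ row B i, E' (v, i) = ∑ v ∈ row B i \ S, ∑ y ∈ S, w v y := by
    rw [← Finset.sum_inter_add_sum_sdiff _ S, Finset.sum_eq_zero fun v hv =>
      hzero v (Finset.mem_of_mem_inter_right hv), zero_add]
    exact Finset.sum_congr rfl fun v hv => hside v (Finset.mem_sdiff.1 hv).2
  have hchips1 : ∑ v ∈ row B (i + 1), E' (v, i + 1) = (row B (i + 1)).card := by
    rw [Finset.card_eq_sum_ones, Nat.cast_sum]
    exact Finset.sum_congr rfl fun v hv => by rw [hup]; simp [ind, hT1 hv]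
  have hchipsS : ∑ v ∈ row B i \ S, ∑ y ∈ S, w v y ≤ cut w S := by
    rw [← cut_compl w hs, cut, compl_compl]
    refine Finset.sum_le_sum_of_subset_of_nonneg (fun v hv => ?_) fun v _ _ =>
      Finset.sum_nonneg fun _ _ => hw _ _
    simpa using (Finset.mem_sdiff.1 hv).2
  rw [hchips0, hdiff] at hrow0
  rw [hchips1, hi2] at hrow1
  have hSne : ∀ T : Finset V, T ⊆ S → T.Nonempty → 1 ≤ cut w T := fun T hT hne =>
    hc.one_le_cut hw hne ⟨u, by simpa using fun hh => hu (hT hh)⟩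
  have hnotboth : ¬ (row B i = ∅ ∧ row B (i + 1) = ∅) := by
    rintro ⟨h5, h6⟩
    obtain ⟨⟨v, j⟩, hv⟩ := hBne
    have hj : j = i ∨ j = i + 1 := by fin_cases i <;> fin_cases j <;> simp
    rw [← mem_row] at hv
    rcases hj with rfl | rfl
    · simp [h5] at hv
    · simp [h6] at hv
  rcases h with ⟨hS1, hS2, -⟩ | ⟨hS1, hS2⟩
  · rcases (row B (i + 1)).eq_empty_or_nonempty with h5 | h5
    · have h6 : row B i \ S = row B i := by rw [← hdiff, h5, Finset.sdiff_empty]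
      -- Here `row B i` misses `S`. Its chips match its edges to `S`, all of which leave it, so
      -- nothing remains to pay for the edges to row `i + 1`.
      have h7 : ∑ v ∈ row B i, ∑ y ∈ S, w v y ≤ cut w (row B i) := by
        refine Finset.sum_le_sum fun v _ => ?_
        refine Finset.sum_le_sum_of_subset_of_nonneg (fun y hy => ?_) fun _ _ _ => hw _ _
        rw [Finset.mem_compl]
        intro hyB
        have := hT0 (Finset.mem_inter.2 ⟨hyB, hy⟩)
        simp [h5] at this
      rw [h6] at hrow0
      exact hnotboth ⟨Finset.card_eq_zero.1 (by omega), h5⟩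
    · have h6 : row B (i + 1) = S :=
        Finset.eq_of_subset_of_card_le hT1 (by have := h5.card_pos; omega)
      rw [h6] at hrow1
      omega
  -- At most `cut w S = 1` vertex outside `S` and two in `S`. Since |V| > 3, the row is not full, so
  -- it has a positive cut unless it is empty.
  · have h5 : (row B i).card ≤ 3 := by
      have h6 := Finset.card_sdiff_add_card_inter (row B i) S
      have h7 := Finset.card_le_card (Finset.inter_subset_right (s₁ := row B i) (s₂ := S))
      have := cut_nonneg w hw (row B i)
      omega
    have h6 : row B i = ∅ := by
      by_contra hne
      have h7 := hc.one_le_cut hw (Finset.nonempty_iff_ne_empty.2 hne) (by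
        rw [Finset.nonempty_iff_ne_empty, Ne, Finset.compl_eq_empty_iff]
        intro h8
        rw [h8, Finset.card_univ] at h5
        omega)
      have h8 : row B i \ S = ∅ := Finset.card_eq_zero.1 (by omega)
      rw [h8, Finset.sum_empty] at hrow0
      omega
    rw [h6, Finset.sdiff_empty] at hrow1
    have h7 : row B (i + 1) ≠ ∅ := fun h7 => hnotboth ⟨h6, h7⟩
    have := hSne _ hT1 (Finset.nonempty_iff_ne_empty.2 h7)
    omega

end Prism

/-! ### The lower bound, and the divisors attaining the gonality. -/

section Prism

variable {V : Type*} [DecidableEq V] {w : V → V → ℤ} [Fintype V]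

/-- A legal firing of a set that does not separate the boundary of `Q` leaves the chips above `Q`
in place, if there is at most one of them. -/
theorem eq_of_legal_of_chips_le_one (hw : ∀ x y, 0 ≤ w x y) {E : V × Fin 2 → ℤ} (hE : Effective E)
    {A : Finset (V × Fin 2)} (hA : Effective (E - lap (prism w) (ind A))) {Q : Finset V}
    (hQ : ConnectedOn w Q) {a : V} (haQ : a ∈ Q) (hconst : (a, 1) ∈ A ↔ (a, 0) ∈ A)
    (hbd : ∀ i, ∀ c ∈ Q, ∀ d ∉ Q, 1 ≤ w c d → ((c, i) ∈ A ↔ (d, i) ∈ A))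
    (hchips : ∀ v ∈ Q, ∀ u ∈ Q, E (v, 0) + E (u, 1) ≤ 1) {v : V} (hv : v ∈ Q) (i : Fin 2) :
    (E - lap (prism w) (ind A)) (v, i) = E (v, i) := by
  have hchips' : ∀ i, ∀ v ∈ Q, ∀ u ∈ Q, E (v, i) + E (u, i + 1) ≤ 1 := fun i v hv u hu => by
    fin_cases i
    · exact hchips v hv u hu
    · have := hchips u hu v hv
      simp only [Fin.isValue, Fin.mk_one, Fin.reduceAdd]
      omega
  have hconst' : ∀ i j, (a, i) ∈ A ↔ (a, j) ∈ A := fun i j => by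
    fin_cases i <;> fin_cases j <;> simp [hconst]
  -- a proper part of a row of `Q` loses a chip
  have hchip : ∀ i, (Q ∩ row A i).Nonempty → (Q \ (Q ∩ row A i)).Nonempty →
      ∃ x ∈ Q, x ∈ row A i ∧ 1 + (1 - ind (row A (i + 1)) x) ≤ E (x, i) := by
    intro i h h'
    obtain ⟨x, hx, y, hy, hxy⟩ := hQ _ Finset.inter_subset_left h h'
    simp only [Finset.mem_inter, Finset.mem_sdiff, not_and] at hx hy
    refine ⟨x, hx.1, hx.2, ?_⟩
    have h1 := lap_row_le hA hx.2
    rw [lap_ind_of_mem w hx.2] at h1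
    have h2 : w x y ≤ ∑ z ∈ (row A i)ᶜ, w x z :=
      Finset.single_le_sum (f := fun z => w x z) (fun z _ => hw x z)
        (Finset.mem_compl.2 (hy.2 hy.1))
    omega
  have hrow : ∀ i, (Q ∩ row A i).Nonempty → Q ⊆ row A i := by
    intro i h y hy
    by_contra hyA
    obtain ⟨x, hxQ, hxA, hx⟩ := hchip i h ⟨y, by simp [hy, hyA]⟩
    -- Otherwise `x` would pay both for an edge in its row and for the edge to its other copy.
    have hx1 : x ∈ row A (i + 1) := by
      by_contra hx1
      have h1 : ind (row A (i + 1)) x = 0 := by simp [ind, hx1]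
      have h2 := hchips' i x hxQ x hxQ
      have h3 := hE (x, i + 1)
      omega
    have h1 : ind (row A (i + 1)) x = 1 := by simp [ind, hx1]
    -- Row `i + 1` over `Q` also has to lose a chip: to the unfired copy of `y` if it is fully
    -- fired, along an edge of the row if not. Together with the chip at `x` this exceeds the bound.
    by_cases hall : Q ⊆ row A (i + 1)
    · have ha : a ∈ row A i := by
        rw [mem_row, hconst' i (i + 1), ← mem_row]
        exact hall haQ
      have h2 := lap_row_le hA (hall hy)
      have h3 : 0 ≤ lap w (ind (row A (i + 1))) y := by
        rw [lap_ind_of_mem w (hall hy)]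
        exact Finset.sum_nonneg fun _ _ => hw _ _
      have hi2 : i + 1 + 1 = i := by fin_cases i <;> rfl
      have h4 : ind (row A (i + 1 + 1)) y = 0 := by simp [ind, hi2, hyA]
      have h5 := hchips' i x hxQ y hy
      omega
    · rw [Finset.not_subset] at hall
      obtain ⟨z, hz, hzA⟩ := hall
      obtain ⟨x', hxQ', -, hx'⟩ := hchip (i + 1) ⟨x, by simp [hxQ, hx1]⟩ ⟨z, by simp [hz, hzA]⟩
      have h2 : 0 ≤ 1 - ind (row A (i + 1 + 1)) x' := by unfold ind; split_ifs <;> omega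
      have h5 := hchips' i x hxQ x' hxQ'
      omega
  have hall : ∀ u ∈ Q, ∀ j, (u, j) ∈ A ↔ (a, 0) ∈ A := fun u hu j => by
    rw [← hconst' j 0, ← mem_row, ← mem_row]
    exact ⟨fun h => hrow j ⟨u, by simp [hu, h]⟩ haQ, fun h => hrow j ⟨a, by simp [haQ, h]⟩ hu⟩
  have hind : ∀ p q, (p ∈ A ↔ q ∈ A) → ind A p - ind A q = 0 := fun p q h => by simp [ind, h]
  rw [Pi.sub_apply, lap_prism, hind _ _ ((hall v hv i).trans (hall v hv (i + 1)).symm), lap,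
    Finset.sum_eq_zero, add_zero, sub_zero]
  intro u _
  by_cases hu : u ∈ Q
  · rw [hind _ _ ((hall v hv i).trans (hall u hu i).symm), mul_zero]
  · by_cases hvu : 1 ≤ w v u
    · rw [hind _ _ (hbd i v hv u hu hvu), mul_zero]
    · rw [show w v u = 0 by have := hw v u; omega, zero_mul]

/-- The chips over `Q` are invariant under all legal firings in the class, so a covering divisor
would have chips on both copies of `a` already. -/
theorem not_covers_of_chips_le_one (hc : CutConnected w) (hs : ∀ x y, w x y = w y x)
    (hw : ∀ x y, 0 ≤ w x y) {a b : V} (hab : a ≠ b) (hl : TwoLinked w a b)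
    {E : V × Fin 2 → ℤ} (hE : Effective E) (hd3 : ∑ p, E p ≤ 3) (hdn : ∑ p, E p < Fintype.card V)
    {Q : Finset V} (hQ : ConnectedOn w Q) (haQ : a ∈ Q)
    (hbd : ∀ c ∈ Q, ∀ d ∉ Q, 1 ≤ w c d → TwoLinked w a c ∧ TwoLinked w a d)
    (hchips : ∀ v ∈ Q, ∀ u ∈ Q, E (v, 0) + E (u, 1) ≤ 1) : ¬ Covers (prism w) E := by
  intro hcov
  have hps := prism_symm hs
  have hpw := prism_nonneg hw
  have hdeg : ∀ (D f : V × Fin 2 → ℤ), ∑ p, (D - lap (prism w) f) p = ∑ p, D p := fun D f => by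
    simp [Finset.sum_sub_distrib, sum_lap _ hps]
  have key : ∀ f, Effective (E - lap (prism w) f) →
      ∀ i, (E - lap (prism w) f) (a, i) = E (a, i) := by
    intro f hf i
    refine (legal_induction (prism w) hpw (D := E) (f := f)
      (p := fun D => Covers (prism w) D ∧ ∑ p, D p = ∑ p, E p ∧
        ∀ v ∈ Q, ∀ i, D (v, i) = E (v, i)) ?_ ⟨hcov, rfl, fun _ _ _ => rfl⟩ hE hf).2.2 a haQ i
    rintro D A ⟨hD1, hD2, hD3⟩ hDe hDA
    refine ⟨hD1.sub_lap _, (hdeg _ _).trans hD2, fun v hv j => ?_⟩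
    rw [← hD3 v hv j]
    rcases legal_dichotomy hc hs hw hab hl hDe (hD2 ▸ hd3) (hD2 ▸ hdn) hDA with h | h
    · refine eq_of_legal_of_chips_le_one hw hDe hDA hQ haQ (h a 1 fun S h h' => absurd h h')
        (fun i c hc d hd hcd => ?_) (fun v hv u hu => ?_) hv j
      · obtain ⟨h1, h2⟩ := hbd c hc d hd hcd
        rw [h c i h1, h d i h2]
      · rw [hD3 v hv, hD3 u hu]
        exact hchips v hv u hu
    · obtain ⟨S, i, hS, ⟨h1, h2⟩ | ⟨h1, h2⟩⟩ := h
      · exact absurd hD1 (hS.not_covers hc hs hw hDe (hD2 ▸ hd3) (hD2 ▸ hdn) hDA h1 h2)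
      -- Firing `Aᶜ` undoes the firing of `A`, so the exceptional firing starts from the new
      -- divisor.
      · have hd := (hdeg D (ind A)).trans hD2
        refine absurd (hD1.sub_lap (ind A)) (hS.not_covers hc hs hw hDA (hd ▸ hd3) (hd ▸ hdn)
          (A := Aᶜ) ?_ h1 h2)
        rw [lap_ind_compl, sub_neg_eq_add, sub_add_cancel]
        exact hDe
  obtain ⟨f, hf, hfa⟩ := hcov (a, 0)
  obtain ⟨g, hg, hga⟩ := hcov (a, 1)
  rw [key f hf] at hfa
  rw [key g hg] at hga
  have := hchips a haQ a haQ
  omega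

/-- On the product of a graph that has a cycle with `K2`, a divisor of positive rank has degree at
least four or at least the number of vertices of the graph. -/
theorem not_covers_of_degree_lt (hc : CutConnected w) (hs : ∀ x y, w x y = w y x)
    (hw : ∀ x y, 0 ≤ w x y) {a b : V} (hab : a ≠ b) (hl : TwoLinked w a b)
    {E : V × Fin 2 → ℤ} (hE : Effective E) (hd3 : ∑ p, E p ≤ 3)
    (hdn : ∑ p, E p < Fintype.card V) : ¬ Covers (prism w) E := by
  obtain ⟨Q, haQ, hbQ, hQ, hQ'⟩ := hc.exists_minimal_cut hs hw hab
  have hb1 : ∀ c ∈ Q, ∀ d ∉ Q, 1 ≤ w c d → TwoLinked w a c := fun c hc d hd h =>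
    hl.of_boundary hs hw haQ hbQ hQ hQ' hc hd h
  have hb2 : ∀ c ∉ Q, ∀ d ∈ Q, 1 ≤ w c d → TwoLinked w b c := fun c hc d hd h =>
    (hl.symm hs).of_boundary (Q := Qᶜ) hs hw (by simpa using hbQ) (by simpa using haQ) hQ'
      (by rwa [compl_compl]) (by simpa using hc) (by simpa using hd) h
  by_cases h : ∀ v ∈ Q, ∀ u ∈ Q, E (v, 0) + E (u, 1) ≤ 1
  · exact not_covers_of_chips_le_one hc hs hw hab hl hE hd3 hdn hQ haQ
      (fun c hc d hd hcd => ⟨hb1 c hc d hd hcd, hl.trans (hb2 d hd c hc (by rwa [hs]))⟩) h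
  by_cases h' : ∀ v ∈ Qᶜ, ∀ u ∈ Qᶜ, E (v, 0) + E (u, 1) ≤ 1
  · refine not_covers_of_chips_le_one hc hs hw hab.symm (hl.symm hs) hE hd3 hdn hQ'
      (by simpa using hbQ) (fun c hc d hd hcd => ?_) h'
    rw [Finset.mem_compl] at hc hd
    rw [not_not] at hd
    exact ⟨hb2 c hc d hd hcd, (hl.symm hs).trans (hb1 d hd c hc (by rwa [hs]))⟩
  -- If the bound fails on both sides, each side holds at least two chips, four in all.
  push Not at h h'
  obtain ⟨v, hv, u, hu, huv⟩ := h
  obtain ⟨v', hv', u', hu', huv'⟩ := h'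
  rw [Finset.mem_compl] at hv' hu'
  have h1 := sum_row_le hE {v, v'} 0
  have h2 := sum_row_le hE {u, u'} 1
  rw [Finset.sum_pair (by rintro rfl; exact hv' hv)] at h1
  rw [Finset.sum_pair (by rintro rfl; exact hu' hu)] at h2
  have h3 := sum_prod_fin_two E 0
  rw [zero_add] at h3
  omega

theorem covers_row_zero :
    Covers (prism w) (fun p => if p.2 = 0 then 1 else 0) := by
  rintro ⟨v, i⟩
  by_cases hi : i = 0
  · refine ⟨0, ?_, ?_⟩
    · rw [lap_zero, sub_zero]
      intro p
      dsimp only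
      split_ifs <;> norm_num
    · rw [lap_zero, sub_zero]
      simp [hi]
  · have hi1 : i = 1 := by omega
    subst hi1
    have h : ∀ u j, ((fun p => if p.2 = 0 then 1 else 0) -
        lap (prism w) (fun p => if p.2 = 0 then 1 else 0) : V × Fin 2 → ℤ) (u, j) =
        if j = 0 then 0 else 1 := fun u j => by
      rw [Pi.sub_apply, lap_prism, lap_of_const w (M := if j = 0 then 1 else 0) fun _ => rfl]
      fin_cases j <;> simp
    refine ⟨fun p => if p.2 = 0 then 1 else 0, fun ⟨u, j⟩ => ?_, ?_⟩
    · rw [h]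
      split_ifs <;> norm_num
    · rw [h]
      simp

/-- A script that agrees on both copies of every vertex moves no chips between the rows, so it acts
on each row as it does on the graph. -/
theorem Covers.prism {D : V → ℤ} (h : Covers w D) :
    Covers (prism w) (fun p => D p.1) := by
  rintro ⟨v, i⟩
  obtain ⟨f, hf, hfv⟩ := h v
  have key : ∀ u j, ((fun p => D p.1) - lap (Multigraph.prism w) (fun p => f p.1) :
      V × Fin 2 → ℤ) (u, j) = (D - lap w f) u := fun u j => by
    rw [Pi.sub_apply, lap_prism, Pi.sub_apply, sub_self, add_zero]
  exact ⟨fun p => f p.1, fun ⟨u, j⟩ => by rw [key]; exact hf u, by rw [key]; exact hfv⟩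

end Prism

/-- The gonality of the product of a connected graph of genus one with `K2`. -/
theorem Connected.gonality_boxProd_K2 {V : Type*} [Fintype V] [DecidableEq V] (G : Multigraph V)
    (hG : G.Connected) (hg : G.genus = 1) :
    (G.boxProd Multigraph.K2).gonality = min (Fintype.card V) 4 := by
  have hc := hG.cutConnected
  have hs := G.wt_symm
  have hw := G.wt_nonneg
  obtain ⟨a, b, hab, hl⟩ := hG.exists_twoLinked hg
  have : Nonempty V := ⟨a⟩
  have hrow : Covers (G.boxProd K2).wt (fun p => if p.2 = 0 then 1 else 0) := by
    rw [wt_boxProd_K2]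
    exact covers_row_zero
  have hrowdeg : degree (fun p : V × Fin 2 => if p.2 = 0 then 1 else 0) = (Fintype.card V : ℕ) := by
    rw [degree, sum_prod_fin_two _ 0]
    simp
  refine le_antisymm (le_min (gonality_le _ hrowdeg hrow) ?_) (le_gonality _ ?_ hrowdeg hrow)
  · refine gonality_le _ (D := fun p => 2 * ind {a} p.1) ?_ ?_
    · rw [degree, sum_prod_fin_two _ 0]
      simp [ind]
    · rw [wt_boxProd_K2]
      refine Covers.prism (D := fun v => 2 * ind {a} v)
        (hc.exists_covering hs hw ?_ (fun v => ?_) ?_)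
      · rw [sum_wt]
        rw [genus] at hg
        omega
      · unfold ind
        split_ifs <;> norm_num
      · simp [ind]
  · intro D hD hcov
    rw [wt_boxProd_K2] at hcov
    by_contra hlt
    push_cast at hlt
    rw [not_le, lt_min_iff] at hlt
    exact not_covers_of_degree_lt hc hs hw hab hl hD (by rw [degree] at hlt; omega) hlt.1 hcov

end Multigraph

theorem mainTheorem5 {V : Type*} [Fintype V] [DecidableEq V] (G : Multigraph V)
    (hG : G.Connected) (hg : G.genus = 1) :
    (G.boxProd Multigraph.K2).gonality = min (Fintype.card V) 4 := by
  exact Multigraph.Connected.gonality_boxProd_K2 G hG hg
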